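/- Let $k$ be a field and let $\mathcal{A}$ be a $k$-linear abelian category that is Hom-finite (all $\mathrm{Hom}_{\mathcal A}(X,Y)$ are finite dimensional over $k$). Write $D=\mathrm{Hom}_k(-,k)$. Assume that $\mathcal{A}$ has a Serre duality, that is, a $k$-linear auto-equivalence $\mathbb{S}\colon\mathcal{A}\to\mathcal{A}$ (the Serre functor) together with $k$-linear isomorphisms $$\phi_{X,Y}\colon D\mathrm{Ext}^1_{\mathcal A}(X,Y)\xrightarrow{\ \sim\ }\mathrm{Hom}_{\mathcal A}(Y,\mathbb{S}X)$$ natural in $X$ and $Y$. Its trace maps are $\mathrm{Tr}_X\colon\mathrm{Ext}^1_{\mathcal A}(X,\mathbb{S}X)\to k$, $\mathrm{Tr}_X([\xi])=\phi_{X,\mathbb{S}X}^{-1}(\mathrm{Id}_{\mathbb{S}X})([\xi])$. For a morphism $f$, write $f.[\xi]$ for the push-out of an extension class along $f$. For every $k$-linear auto-equivalence $F$ of $\mathcal{A}$, let $\sigma_F\colon F\mathbb{S}\to\mathbb{S}F$ be the commutator isomorphism, i.e. the unique natural isomorphism with $\mathrm{Tr}_X([\xi])=\mathrm{Tr}_{FX}((\sigma_F)_X.[F(\xi)])$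 for all $X$ and all $[\xi]\in\mathrm{Ext}^1_{\mathcal A}(X,\mathbb{S}X)$. Let $G$ be a finite group whose order is invertible in $k$, and let $\{F_g,\varepsilon_{g,h}\mid g,h\in G\}$ be a $k$-linear action of $G$ on $\mathcal{A}$: each $F_g$ is a $k$-linear auto-equivalence of $\mathcal A$, and the $\varepsilon_{g,h}\colon F_gF_h\to F_{gh}$ are natural isomorphisms with $\varepsilon_{gh,l}\circ\varepsilon_{g,h}F_l=\varepsilon_{g,hl}\circ F_g\varepsilon_{h,l}$ for all $g,h,l\in G$. Let $\mathcal{A}^G$ be the category of $G$-equivariant objects: its objects are pairs $(X,\alpha)$ with isomorphisms $\alpha_g\colon X\to F_gX$ such that $\alpha_{gh}=(\varepsilon_{g,h})_X\circ F_g(\alpha_h)\circ\alpha_g$, and its morphisms $(X,\alpha)\to(Y,\beta)$ are the $f\colon X\to Y$ with $\beta_g\circ f=F_g(f)\circ\alpha_g$ for all $g\in G$. Let $U\colon\mathcal{A}^G\to\mathcal{A}$ be the forgetful functor. Write $\sigma_g=\sigma_{F_g}$ and let $\mathbb{S}^G\colon\mathcal{A}^G\to\mathcal{A}^G$ be the functor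 given by $$\mathbb{S}^G(X,\alpha)=(\mathbb{S}X,\tilde\alpha),\qquad \tilde\alpha_g=(\sigma_g)_X^{-1}\circ\mathbb{S}(\alpha_g),\qquad \mathbb{S}^G(f)=\mathbb{S}(f).$$ Then, for all $(X,\alpha)$ and $(Y,\beta)$ in $\mathcal{A}^G$, the $k$-linear map $$\psi\colon\mathrm{Hom}_{\mathcal{A}^G}((Y,\beta),\mathbb{S}^G(X,\alpha))\longrightarrow D\mathrm{Ext}^1_{\mathcal{A}^G}((X,\alpha),(Y,\beta)),\qquad \psi(f)([\xi])=\mathrm{Tr}_X(U(f.[\xi])),$$ is an isomorphism, natural in $(X,\alpha)$ and in $(Y,\beta)$. Consequently the Hom-finite abelian category $\mathcal{A}^G$ has a Serre duality, given by $\psi^{-1}$, whose Serre functor is the $k$-linear auto-equivalence $\mathbb{S}^G$. -/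

import Mathlib

open CategoryTheory CategoryTheory.Limits CategoryTheory.Abelian

universe w w' w'' v v' v'' u u' u'' uG uk

namespace SerreEquivariant

section ExtLemmas

variable {C : Type u} [Category.{v} C] [Abelian C]

open Pretriangulated DerivedCategory in
theorem exists_epi_comp_eq_zero [HasExt.{w} C] {X Y : C} (ξ : Ext.{w} X Y 1) :
    ∃ (E : C) (p : E ⟶ X), Epi p ∧ (Ext.mk₀ p).comp ξ (zero_add 1) = 0 := by
  let := HasDerivedCategory.standard C
  obtain ⟨E, i, p, hT⟩ := distinguished_cocone_triangle₂ (C := DerivedCategory C) ξ.hom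
  have hLE : E.IsLE 0 := TStructure.t.isLE₂ _ hT 0
    (inferInstance : ((singleFunctor C 0).obj Y).IsLE 0)
    (inferInstance : ((singleFunctor C 0).obj X).IsLE 0)
  have hGE : E.IsGE 0 := TStructure.t.isGE₂ _ hT 0
    (inferInstance : ((singleFunctor C 0).obj Y).IsGE 0)
    (inferInstance : ((singleFunctor C 0).obj X).IsGE 0)
  obtain ⟨E', ⟨e⟩⟩ := exists_iso_singleFunctor_obj_of_isGE_of_isLE E 0
  obtain ⟨q, hq⟩ := (singleFunctor C 0).map_surjective (e.inv ≫ p)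
  refine ⟨E', q, ?_, ?_⟩
  · have h0 : Epi ((homologyFunctor C 0).map p) := by
      refine (HomologySequence.epi_homologyMap_mor₂_iff _ hT 0 1).2 ?_
      apply IsZero.eq_of_tgt
      exact isZero_of_isLE ((singleFunctor C 0).obj Y) 0 1 (by lia)
    have h1 : Epi ((homologyFunctor C 0).map ((singleFunctor C 0).map q)) := by
      rw [hq, Functor.map_comp]
      infer_instance
    have h2 := (singleFunctorCompHomologyFunctorIso C 0).hom.naturality q
    have h3 : q = (singleFunctorCompHomologyFunctorIso C 0).inv.app E' ≫
        (homologyFunctor C 0).map ((singleFunctor C 0).map q) ≫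
        (singleFunctorCompHomologyFunctorIso C 0).hom.app X := by
      dsimp at h2
      rw [h2]; simp
    rw [h3]
    infer_instance
  · ext
    have : p ≫ ξ.hom = 0 := comp_distTriang_mor_zero₂₃ _ hT
    rw [Ext.comp_hom, Ext.mk₀_hom, ShiftedHom.mk₀_comp, hq, Category.assoc, this]
    simp

/-- Every class in `Ext¹` is the push-out of the class of a short exact sequence. -/
theorem ext_one_induction [HasExt.{w} C] {motive : ∀ {X Y : C}, Ext.{w} X Y 1 → Prop}
    (h : ∀ (S : ShortComplex C) (hS : S.ShortExact) (Y : C) (f : S.X₁ ⟶ Y),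
      motive (hS.extClass.comp (Ext.mk₀ f) (add_zero 1))) {X Y : C} (ξ : Ext.{w} X Y 1) :
    motive ξ := by
  obtain ⟨E, p, hp, h0⟩ := exists_epi_comp_eq_zero ξ
  have hS : (ShortComplex.mk _ _ (kernel.condition p)).ShortExact :=
    { exact := ShortComplex.exact_kernel p }
  obtain ⟨x, hx⟩ := Ext.contravariant_sequence_exact₃ hS Y ξ h0 (add_zero 1)
  obtain ⟨f, rfl⟩ := (Ext.mk₀_bijective _ _).2 x
  rw [← hx]
  exact h _ hS _ f

theorem mapExactFunctor_id [HasExt.{w} C] {X Y : C} (ξ : Ext.{w} X Y 1) :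
    ξ.mapExactFunctor (𝟭 C) = ξ := by
  refine ext_one_induction (motive := fun ξ => ξ.mapExactFunctor (𝟭 C) = ξ) ?_ ξ
  intro S hS Y f
  refine (Ext.mapExactFunctor_comp (𝟭 C) _ _ _).trans ?_
  refine congrArg₂ (fun a b => Ext.comp a b (add_zero 1)) ?_ ?_
  · exact Ext.mapExactFunctor_extClass _ _
  · exact Ext.mapExactFunctor_mk₀ _ _

variable {D : Type u'} [Category.{v'} D] [Abelian D]

theorem mapExactFunctor_extClass_comp [HasExt.{w} C] [HasExt.{w'} D]
    (F : C ⥤ D) [F.Additive] [PreservesFiniteLimits F] [PreservesFiniteColimits F]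
    {S : ShortComplex C} (hS : S.ShortExact) {Y : C} (f : S.X₁ ⟶ Y) :
    Ext.mapExactFunctor F (hS.extClass.comp (Ext.mk₀ f) (add_zero 1)) =
      Ext.comp (X := F.obj S.X₃) (Y := F.obj S.X₁) (hS.map_of_exact F).extClass
        (Ext.mk₀ (F.map f)) (add_zero 1) := by
  refine (Ext.mapExactFunctor_comp F _ _ _).trans ?_
  refine congrArg₂ (fun a b => Ext.comp a b (add_zero 1)) ?_ ?_
  · exact Ext.mapExactFunctor_extClass _ _
  · exact Ext.mapExactFunctor_mk₀ _ _

theorem mapExactFunctor_comp_functor [HasExt.{w} C] [HasExt.{w'} D]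
    {B : Type u''} [Category.{v''} B] [Abelian B] [HasExt.{w''} B]
    (F : C ⥤ D) [F.Additive] [PreservesFiniteLimits F] [PreservesFiniteColimits F]
    (H : D ⥤ B) [H.Additive] [PreservesFiniteLimits H] [PreservesFiniteColimits H]
    [PreservesFiniteLimits (F ⋙ H)] [PreservesFiniteColimits (F ⋙ H)]
    {X Y : C} (ξ : Ext.{w} X Y 1) :
    ξ.mapExactFunctor (F ⋙ H) = (ξ.mapExactFunctor F).mapExactFunctor H := by
  refine ext_one_induction
    (motive := fun ξ => ξ.mapExactFunctor (F ⋙ H) = (ξ.mapExactFunctor F).mapExactFunctor H) ?_ ξ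
  intro S hS Y f
  refine (mapExactFunctor_extClass_comp (F ⋙ H) hS f).trans ?_
  rw [mapExactFunctor_extClass_comp F hS f]
  exact (mapExactFunctor_extClass_comp H (hS.map_of_exact F) (F.map f)).symm

theorem mapExactFunctor_naturality [HasExt.{w} C] [HasExt.{w'} D]
    (F F' : C ⥤ D) [F.Additive] [PreservesFiniteLimits F] [PreservesFiniteColimits F]
    [F'.Additive] [PreservesFiniteLimits F'] [PreservesFiniteColimits F'] (θ : F ⟶ F')
    {X Y : C} (ξ : Ext.{w} X Y 1) :
    (ξ.mapExactFunctor F).comp (Ext.mk₀ (θ.app Y)) (add_zero 1) =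
      (Ext.mk₀ (θ.app X)).comp (ξ.mapExactFunctor F') (zero_add 1) := by
  refine ext_one_induction (motive := fun {X Y} ξ =>
    (ξ.mapExactFunctor F).comp (Ext.mk₀ (θ.app Y)) (add_zero 1) =
      (Ext.mk₀ (θ.app X)).comp (ξ.mapExactFunctor F') (zero_add 1)) ?_ ξ
  intro S hS Y f
  have h : (hS.extClass.mapExactFunctor F).comp (Ext.mk₀ (θ.app S.X₁)) (add_zero 1) =
      (Ext.mk₀ (θ.app S.X₃)).comp (hS.extClass.mapExactFunctor F') (zero_add 1) := by
    rw [Ext.mapExactFunctor_extClass, Ext.mapExactFunctor_extClass]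
    exact ShortComplex.ShortExact.extClass_naturality (hS.map_of_exact F) (hS.map_of_exact F')
      (S.mapNatTrans θ)
  rw [Ext.mapExactFunctor_comp, Ext.mapExactFunctor_comp, Ext.mapExactFunctor_mk₀,
    Ext.mapExactFunctor_mk₀, Ext.comp_assoc_of_third_deg_zero, Ext.mk₀_comp_mk₀, θ.naturality,
    ← Ext.mk₀_comp_mk₀, ← Ext.comp_assoc_of_third_deg_zero, h,
    Ext.comp_assoc_of_third_deg_zero]

end ExtLemmas

section ExtOne

variable (k : Type uk) [Field k] {C : Type u} [Category.{v} C] [Abelian C]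

/-- The space `Ext¹(X, Y)` of an abelian category. -/
abbrev Ext1 (X Y : C) : Type (max u v) :=
  letI : HasExt.{max u v} C := HasExt.standard C
  Ext.{max u v} X Y 1

attribute [local instance] HasExt.standard

variable [Linear k C]

/-- Push-out of extension classes, `[ξ] ↦ g.[ξ]`. -/
noncomputable def push (X : C) {Y Y' : C} (g : Y ⟶ Y') : Ext1 X Y →ₗ[k] Ext1 X Y' where
  toFun ξ := Ext.comp ξ (Ext.mk₀ g) (add_zero 1)
  map_add' _ _ := Ext.add_comp _ _ _ _
  map_smul' _ _ := Ext.smul_comp _ _ _ _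

/-- Pull-back of extension classes, `[ξ] ↦ [ξ].f`. -/
noncomputable def pull {X' X : C} (f : X' ⟶ X) (Y : C) : Ext1 X Y →ₗ[k] Ext1 X' Y where
  toFun ξ := Ext.comp (Ext.mk₀ f) ξ (zero_add 1)
  map_add' _ _ := Ext.comp_add _ _ _ _
  map_smul' _ _ := Ext.comp_smul _ _ _ _

/-- The map `[ξ] ↦ [F(ξ)]` on extension classes, for a `k`-linear exact functor `F`. -/
noncomputable def mapExt {D : Type u'} [Category.{v'} D] [Abelian D] [Linear k D] (F : C ⥤ D)
    [F.Additive] [F.Linear k] [PreservesFiniteLimits F] [PreservesFiniteColimits F] (X Y : C) :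
    Ext1 X Y →ₗ[k] Ext1 (F.obj X) (F.obj Y) :=
  F.mapExtLinearMap k X Y 1

variable {k}

theorem push_id {X Y : C} (ξ : Ext1 X Y) : push k X (𝟙 Y) ξ = ξ := Ext.comp_mk₀_id _

theorem pull_id {X Y : C} (ξ : Ext1 X Y) : pull k (𝟙 X) Y ξ = ξ := Ext.mk₀_id_comp _

theorem push_comp {X Y Y' Y'' : C} (f : Y ⟶ Y') (g : Y' ⟶ Y'') (ξ : Ext1 X Y) :
    push k X (f ≫ g) ξ = push k X g (push k X f ξ) := by
  simp [push]

theorem pull_comp {X X' X'' Y : C} (f : X'' ⟶ X') (g : X' ⟶ X) (ξ : Ext1 X Y) :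
    pull k (f ≫ g) Y ξ = pull k f Y (pull k g Y ξ) := by
  simp [pull]

theorem pull_push {X X' Y Y' : C} (f : X' ⟶ X) (g : Y ⟶ Y') (ξ : Ext1 X Y) :
    pull k f Y' (push k X g ξ) = push k X' g (pull k f Y ξ) := by
  simp [pull, push]

theorem push_add {X Y Y' : C} (g g' : Y ⟶ Y') (ξ : Ext1 X Y) :
    push k X (g + g') ξ = push k X g ξ + push k X g' ξ := by
  simp [push, Ext.mk₀_add]

theorem push_smul {X Y Y' : C} (r : k) (g : Y ⟶ Y') (ξ : Ext1 X Y) :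
    push k X (r • g) ξ = r • push k X g ξ := by
  simp [push, Ext.mk₀_smul]

theorem push_injective (X : C) {Y Y' : C} (g : Y ⟶ Y') [IsIso g] :
    Function.Injective (push k X g) := fun a b h => by
  have := congrArg (push k X (inv g)) h
  simpa [← push_comp, push_id] using this

theorem pull_injective {X X' : C} (f : X' ⟶ X) (Y : C) [IsIso f] :
    Function.Injective (pull k f Y) := fun a b h => by
  have := congrArg (pull k (inv f) Y) h
  simpa [← pull_comp, pull_id] using this

section

variable {D : Type u'} [Category.{v'} D] [Abelian D] [Linear k D] (F : C ⥤ D)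
    [F.Additive] [F.Linear k] [PreservesFiniteLimits F] [PreservesFiniteColimits F]

theorem mapExt_push {X Y Y' : C} (g : Y ⟶ Y') (ξ : Ext1 X Y) :
    mapExt k F X Y' (push k X g ξ) = push k _ (F.map g) (mapExt k F X Y ξ) := by
  refine (Ext.mapExactFunctor_comp F _ _ (add_zero 1)).trans ?_
  rw [Ext.mapExactFunctor_mk₀]
  rfl

theorem mapExt_pull {X X' Y : C} (f : X' ⟶ X) (ξ : Ext1 X Y) :
    mapExt k F X' Y (pull k f Y ξ) = pull k (F.map f) _ (mapExt k F X Y ξ) := by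
  refine (Ext.mapExactFunctor_comp F _ _ (zero_add 1)).trans ?_
  rw [Ext.mapExactFunctor_mk₀]
  rfl

theorem mapExt_naturality (F' : C ⥤ D)
    [F'.Additive] [F'.Linear k] [PreservesFiniteLimits F'] [PreservesFiniteColimits F']
    (θ : F ⟶ F') {X Y : C} (ξ : Ext1 X Y) :
    push k _ (θ.app Y) (mapExt k F X Y ξ) = pull k (θ.app X) _ (mapExt k F' X Y ξ) :=
  mapExactFunctor_naturality F F' θ ξ

theorem mapExt_comp {B : Type u''} [Category.{v''} B] [Abelian B] [Linear k B] (H : D ⥤ B)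
    [H.Additive] [H.Linear k] [PreservesFiniteLimits H] [PreservesFiniteColimits H]
    [PreservesFiniteLimits (F ⋙ H)] [PreservesFiniteColimits (F ⋙ H)]
    {X Y : C} (ξ : Ext1 X Y) :
    mapExt k (F ⋙ H) X Y ξ = mapExt k H _ _ (mapExt k F X Y ξ) :=
  mapExactFunctor_comp_functor F H ξ

theorem mapExt_id {X Y : C} (ξ : Ext1 X Y) : mapExt k (𝟭 C) X Y ξ = ξ :=
  mapExactFunctor_id ξ

end

section

variable {D : Type u'} [Category.{v'} D] [Abelian D] [Linear k D]

theorem inv_additive (F : C ⥤ D) [h : F.Additive] [F.IsEquivalence] : F.inv.Additive :=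
  haveI : F.asEquivalence.functor.Additive := h
  F.asEquivalence.inverse_additive

theorem inv_linear (F : C ⥤ D) [F.Additive] [h : F.Linear k] [F.IsEquivalence] :
    F.inv.Linear k :=
  haveI : F.asEquivalence.functor.Linear k := h
  inferInstanceAs (F.asEquivalence.inverse.Linear k)

theorem mapExt_injective (F : C ⥤ D) [F.Additive] [F.Linear k] [F.IsEquivalence] (X Y : C) :
    Function.Injective (mapExt k F X Y) := by
  intro a b h
  have : F.inv.Additive := inv_additive F
  have : F.inv.Linear k := inv_linear F
  let η : 𝟭 C ≅ F ⋙ F.inv := F.asEquivalence.unitIso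
  have ha := mapExt_naturality (k := k) _ _ η.hom a
  have hb := mapExt_naturality (k := k) _ _ η.hom b
  have h' := congrArg (mapExt k F.inv _ _) h
  rw [← mapExt_comp, ← mapExt_comp] at h'
  rw [mapExt_id] at ha hb
  apply push_injective (k := k) X (η.hom.app Y)
  refine ha.trans (Eq.trans ?_ hb.symm)
  exact congrArg _ h'

theorem mapExt_bijective (F : C ⥤ D) [F.Additive] [F.Linear k] [F.IsEquivalence] (X Y : C) :
    Function.Bijective (mapExt k F X Y) := by
  refine ⟨mapExt_injective F X Y, fun ζ => ?_⟩
  have : F.inv.Additive := inv_additive F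
  have : F.inv.Linear k := inv_linear F
  let η : 𝟭 C ≅ F ⋙ F.inv := F.asEquivalence.unitIso
  let ξ : Ext1 X Y := push k X (η.inv.app Y) (pull k (η.hom.app X) _ (mapExt k F.inv _ _ ζ))
  refine ⟨ξ, mapExt_injective (k := k) F.inv _ _ ?_⟩
  have h := mapExt_naturality (k := k) _ _ η.hom ξ
  rw [mapExt_id, mapExt_comp] at h
  apply pull_injective (k := k) (η.hom.app X)
  refine h.symm.trans ?_
  refine (push_comp (k := k) (η.inv.app Y) (η.hom.app Y) _).symm.trans ?_
  rw [Iso.inv_hom_id_app]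
  exact push_id _

end

end ExtOne

section Serre

variable (k : Type uk) [Field k] {C : Type u} [Category.{v} C] [Abelian C] [Linear k C]

/-- A Serre duality on `C` with Serre functor `S`: the functor `S` is a `k`-linear
auto-equivalence, and there are `k`-linear isomorphisms `φ X Y : D Ext¹(X, Y) ≃ Hom(Y, S X)`,
natural in `X` and `Y`. -/
structure SerreDuality (S : C ⥤ C) where
  isEquivalence : S.IsEquivalence
  additive : S.Additive
  linear : S.Linear k
  φ (X Y : C) : Module.Dual k (Ext1 X Y) ≃ₗ[k] (Y ⟶ S.obj X)
  natural_left {X X' : C} (f : X ⟶ X') (Y : C) (u : Module.Dual k (Ext1 X Y)) :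
    φ X' Y (u ∘ₗ pull k f Y) = φ X Y u ≫ S.map f
  natural_right (X : C) {Y Y' : C} (g : Y ⟶ Y') (u : Module.Dual k (Ext1 X Y')) :
    φ X Y (u ∘ₗ push k X g) = g ≫ φ X Y' u

namespace SerreDuality

variable {k} {S : C ⥤ C} (D : SerreDuality k S)

/-- The trace map `Tr_X : Ext¹(X, S X) → k`. -/
noncomputable def trace (X : C) : Module.Dual k (Ext1 X (S.obj X)) :=
  (D.φ X (S.obj X)).symm (𝟙 (S.obj X))

theorem trace_push {X Y : C} (f : Y ⟶ S.obj X) (ξ : Ext1 X Y) :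
    D.trace X (push k X f ξ) = (D.φ X Y).symm f ξ := by
  have h := D.natural_right X f (D.trace X)
  rw [← LinearEquiv.eq_symm_apply] at h
  have h2 := LinearMap.congr_fun h ξ
  simpa [trace] using h2

theorem trace_pull {X X' : C} (f : X' ⟶ X) (ξ : Ext1 X (S.obj X')) :
    D.trace X' (pull k f _ ξ) = D.trace X (push k X (S.map f) ξ) := by
  have h := D.natural_left f (S.obj X') (D.trace X')
  rw [← LinearEquiv.eq_symm_apply] at h
  have h2 := LinearMap.congr_fun h ξ
  rw [trace_push]
  simpa [trace] using h2

theorem hom_ext {X Y : C} {f f' : Y ⟶ S.obj X}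
    (h : ∀ ξ : Ext1 X Y, D.trace X (push k X f ξ) = D.trace X (push k X f' ξ)) : f = f' := by
  apply (D.φ X Y).symm.injective
  ext ξ
  simpa [trace_push] using h ξ

/-- The defining property `Tr_X([ξ]) = Tr_{FX}((σ_F)_X.[F(ξ)])` of the commutator isomorphism
`σ_F : F S ≅ S F` of a `k`-linear auto-equivalence `F`. -/
def IsCommutator (F : C ⥤ C) [F.Additive] [F.Linear k] [F.IsEquivalence]
    (σ : S ⋙ F ≅ F ⋙ S) : Prop :=
  ∀ (X : C) (ξ : Ext1 X (S.obj X)),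
    D.trace X ξ =
      D.trace (F.obj X) (push k (F.obj X) (σ.hom.app X) (mapExt k F X (S.obj X) ξ))

section

variable (F : C ⥤ C) [F.Additive] [F.Linear k] [F.IsEquivalence]

theorem exists_commutator_app (X : C) : ∃ s : F.obj (S.obj X) ⟶ S.obj (F.obj X),
    ∀ ξ : Ext1 X (S.obj X), D.trace X ξ =
      D.trace (F.obj X) (push k (F.obj X) s (mapExt k F X (S.obj X) ξ)) := by
  let e := LinearEquiv.ofBijective (mapExt k F X (S.obj X)) (mapExt_bijective F X (S.obj X))
  refine ⟨D.φ _ _ (D.trace X ∘ₗ e.symm.toLinearMap), fun ξ => ?_⟩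
  rw [trace_push, LinearEquiv.symm_apply_apply]
  have : e.symm (mapExt k F X (S.obj X) ξ) = ξ := e.symm_apply_apply ξ
  simp [this]

variable {F} in
theorem isIso_of_commutator {X : C} (s : F.obj (S.obj X) ⟶ S.obj (F.obj X))
    (hs : ∀ ξ : Ext1 X (S.obj X), D.trace X ξ =
      D.trace (F.obj X) (push k (F.obj X) s (mapExt k F X (S.obj X) ξ))) : IsIso s := by
  have key : ∀ {Y : C} (f : Y ⟶ S.obj X) (ξ : Ext1 X Y),
      D.trace (F.obj X) (push k _ (F.map f ≫ s) (mapExt k F X Y ξ)) =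
        D.trace X (push k X f ξ) := by
    intro Y f ξ
    rw [push_comp, ← mapExt_push, ← hs]
  have hsplit : ∃ r, r ≫ s = 𝟙 _ := by
    let e := F.objObjPreimageIso (S.obj (F.obj X))
    set Y := F.objPreimage (S.obj (F.obj X))
    let f : Y ⟶ S.obj X := D.φ X Y ((D.φ _ _).symm e.hom ∘ₗ mapExt k F X Y)
    have : F.map f ≫ s = e.hom := by
      apply D.hom_ext
      intro ζ
      obtain ⟨ξ, rfl⟩ := (mapExt_bijective (k := k) F X Y).2 ζ
      rw [key, trace_push, trace_push]
      simp [f]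
    exact ⟨e.inv ≫ F.map f, by simp [this]⟩
  have hmono : Mono s := by
    constructor
    intro Z t t' h
    let e := F.objObjPreimageIso Z
    obtain ⟨a, ha⟩ := F.map_surjective (e.hom ≫ t)
    obtain ⟨b, hb⟩ := F.map_surjective (e.hom ≫ t')
    have hab : a = b := by
      apply D.hom_ext
      intro ξ
      rw [← key, ← key, ha, hb, Category.assoc, Category.assoc, h]
    rw [← cancel_epi e.hom, ← ha, ← hb, hab]
  obtain ⟨r, hr⟩ := hsplit
  exact ⟨r, by rw [← cancel_mono s]; simp [hr], hr⟩

/-- A `k`-linear auto-equivalence has exactly one commutator isomorphism. -/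
theorem existsUnique_commutator : ∃! σ : S ⋙ F ≅ F ⋙ S, D.IsCommutator F σ := by
  choose s hs using D.exists_commutator_app F
  have := fun X => D.isIso_of_commutator (s X) (hs X)
  refine ⟨NatIso.ofComponents (fun X => asIso (s X)) ?_, ?_, ?_⟩
  · intro X X' f
    dsimp
    apply D.hom_ext
    intro ζ
    obtain ⟨ξ, rfl⟩ := (mapExt_bijective (k := k) F X' (S.obj X)).2 ζ
    rw [push_comp, ← mapExt_push, ← hs, push_comp, ← D.trace_pull (F.map f), pull_push,
      ← mapExt_pull, ← hs, trace_pull]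
  · intro X ξ
    exact hs X ξ
  · intro τ hτ
    ext X
    apply D.hom_ext
    intro ζ
    obtain ⟨ξ, rfl⟩ := (mapExt_bijective (k := k) F X (S.obj X)).2 ζ
    exact (hτ X ξ).symm.trans (hs X ξ)

/-- The commutator isomorphism `σ_F : F S ≅ S F`. -/
noncomputable def commutator : S ⋙ F ≅ F ⋙ S := (D.existsUnique_commutator F).choose

theorem isCommutator_commutator : D.IsCommutator F (D.commutator F) :=
  (D.existsUnique_commutator F).choose_spec.1

end

theorem commutator_comp (F F₁ F₂ : C ⥤ C) [F.Additive] [F.Linear k] [F.IsEquivalence]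
    [F₁.Additive] [F₁.Linear k] [F₁.IsEquivalence] [F₂.Additive] [F₂.Linear k] [F₂.IsEquivalence]
    (θ : F₂ ⋙ F₁ ≅ F) (X : C) :
    θ.hom.app (S.obj X) ≫ (D.commutator F).hom.app X =
      F₁.map ((D.commutator F₂).hom.app X) ≫ (D.commutator F₁).hom.app (F₂.obj X) ≫
        S.map (θ.hom.app X) := by
  have hF := D.isCommutator_commutator F X
  have h₁ := D.isCommutator_commutator F₁ (F₂.obj X)
  have h₂ := D.isCommutator_commutator F₂ X
  apply D.hom_ext
  intro ζ
  obtain ⟨ξ, hξ⟩ := (mapExt_bijective (k := k) F X (S.obj X)).2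
    (push k _ (θ.hom.app (S.obj X)) ζ)
  have hn := mapExt_naturality (k := k) _ _ θ.hom ξ
  rw [hξ, pull_push] at hn
  have hn' := push_injective (k := k) _ _ hn
  rw [mapExt_comp] at hn'
  rw [push_comp, ← hξ, ← hF, ← Category.assoc, push_comp, ← trace_pull, pull_push, ← hn',
    push_comp, h₂, h₁]
  exact congrArg _ (congrArg _ (mapExt_push (k := k) F₁ _ _))

end SerreDuality

end Serre

section Action

/-- A `k`-linear action of a group `G` on a `k`-linear category `A`: `k`-linear auto-equivalences
`F g` with natural isomorphisms `ε g h : F_g F_h ≅ F_{gh}` (where `F_g F_h` applies `F_h` first)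
subject to the 2-cocycle condition. -/
structure LinearAction (k : Type uk) [Field k] (G : Type uG) [Group G]
    (A : Type u) [Category.{v} A] [Preadditive A] [Linear k A] where
  F : G → A ⥤ A
  isEquivalence (g : G) : (F g).IsEquivalence
  additive (g : G) : (F g).Additive
  linear (g : G) : (F g).Linear k
  ε (g h : G) : F h ⋙ F g ≅ F (g * h)
  cocycle (g h l : G) (X : A) :
    (ε g h).hom.app ((F l).obj X) ≫ (ε (g * h) l).hom.app X ≫
        (eqToHom (congrArg F (mul_assoc g h l))).app X =
      (F g).map ((ε h l).hom.app X) ≫ (ε g (h * l)).hom.app X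

attribute [instance] LinearAction.isEquivalence LinearAction.additive LinearAction.linear

variable {k : Type uk} [Field k] {G : Type uG} [Group G]

section

variable {A : Type u} [Category.{v} A] [Preadditive A] [Linear k A]

/-- A `G`-equivariant object `(X, α)`. -/
structure EquivariantObject (ρ : LinearAction k G A) where
  obj : A
  α (g : G) : obj ≅ (ρ.F g).obj obj
  α_mul (g h : G) :
    (α (g * h)).hom = (α g).hom ≫ (ρ.F g).map (α h).hom ≫ (ρ.ε g h).hom.app obj

namespace EquivariantObject

variable {ρ : LinearAction k G A}

/-- Morphisms of `G`-equivariant objects. -/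
@[ext]
structure Hom (X Y : EquivariantObject ρ) where
  hom : X.obj ⟶ Y.obj
  comm (g : G) : hom ≫ (Y.α g).hom = (X.α g).hom ≫ (ρ.F g).map hom

/-- The category `A^G` of `G`-equivariant objects. -/
instance : Category (EquivariantObject ρ) where
  Hom := Hom
  id X := { hom := 𝟙 X.obj, comm := by simp }
  comp f f' :=
    { hom := f.hom ≫ f'.hom
      comm := fun g => by rw [Category.assoc, f'.comm, ← Category.assoc, f.comm]; simp }

@[simp] theorem id_hom (X : EquivariantObject ρ) : Hom.hom (𝟙 X) = 𝟙 X.obj := rfl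

@[simp] theorem comp_hom {X Y Z : EquivariantObject ρ} (f : X ⟶ Y) (f' : Y ⟶ Z) :
    Hom.hom (f ≫ f') = Hom.hom f ≫ Hom.hom f' := rfl

@[ext] theorem hom_ext {X Y : EquivariantObject ρ} {f f' : X ⟶ Y}
    (h : Hom.hom f = Hom.hom f') : f = f' := Hom.ext h

variable (ρ) in
/-- The forgetful functor `U : A^G ⥤ A`. -/
def forget : EquivariantObject ρ ⥤ A where
  obj X := X.obj
  map f := Hom.hom f

instance : (forget ρ).Faithful where
  map_injective h := hom_ext h

instance : (forget ρ).ReflectsIsomorphisms where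
  reflects {X Y} f hf := by
    have hf' : IsIso (Hom.hom f) := hf
    refine ⟨{ hom := inv (Hom.hom f), comm := fun g => ?_ }, ?_, ?_⟩
    · rw [IsIso.inv_comp_eq, ← Category.assoc, Hom.comm f, Category.assoc, ← Functor.map_comp,
        IsIso.hom_inv_id, CategoryTheory.Functor.map_id, Category.comp_id]
    · ext; exact IsIso.hom_inv_id _
    · ext; exact IsIso.inv_hom_id _

section

variable (X Y : EquivariantObject ρ)

/-- `Hom_{A^G}(X, Y)` as a subspace of `Hom_A(X, Y)`. -/
def homSubmodule : Submodule k (X.obj ⟶ Y.obj) where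
  carrier := {f | ∀ g, f ≫ (Y.α g).hom = (X.α g).hom ≫ (ρ.F g).map f}
  add_mem' {a b} ha hb g := by simp [ha g, hb g]
  zero_mem' g := by simp
  smul_mem' c a ha g := by simp [ha g]

/-- Morphisms of equivariant objects are the elements of `homSubmodule`. -/
def homEquiv : (X ⟶ Y) ≃ homSubmodule X Y where
  toFun f := ⟨Hom.hom f, Hom.comm f⟩
  invFun f := { hom := f.1, comm := f.2 }

instance : AddCommGroup (X ⟶ Y) := (homEquiv X Y).addCommGroup

instance : Module k (X ⟶ Y) := (homEquiv X Y).module k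

end

@[simp] theorem add_hom {X Y : EquivariantObject ρ} (f f' : X ⟶ Y) :
    Hom.hom (f + f') = Hom.hom f + Hom.hom f' := rfl

@[simp] theorem smul_hom {X Y : EquivariantObject ρ} (r : k) (f : X ⟶ Y) :
    Hom.hom (r • f) = r • Hom.hom f := rfl

instance : Preadditive (EquivariantObject ρ) where
  add_comp _ _ _ _ _ _ := by ext; simp
  comp_add _ _ _ _ _ _ := by ext; simp

instance : Linear k (EquivariantObject ρ) where
  smul_comp _ _ _ _ _ _ := by ext; simp
  comp_smul _ _ _ _ _ _ := by ext; simp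

instance : (forget ρ).Additive where

instance : (forget ρ).Linear k where

section Limits

universe uJ vJ

variable {J : Type uJ} [Category.{vJ} J] (K : J ⥤ EquivariantObject ρ)

/-- The structure maps `α_g` of a diagram of equivariant objects. -/
def diagramIso (g : G) : K ⋙ forget ρ ≅ (K ⋙ forget ρ) ⋙ ρ.F g :=
  NatIso.ofComponents (fun j => (K.obj j).α g) (fun f => Hom.comm (K.map f) g)

section

variable {K} {c : Cone (K ⋙ forget ρ)} (hc : IsLimit c)

/-- The structure map `α_g` on a limit. -/
noncomputable def limitIso (g : G) : c.pt ≅ (ρ.F g).obj c.pt :=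
  IsLimit.conePointsIsoOfNatIso hc (isLimitOfPreserves (ρ.F g) hc) (diagramIso K g)

/-- The projections of a cone. -/
def proj (c : Cone (K ⋙ forget ρ)) (j : J) : c.pt ⟶ (K.obj j).obj := c.π.app j

theorem limitIso_proj (g : G) (j : J) :
    (limitIso hc g).hom ≫ (ρ.F g).map (proj c j) = proj c j ≫ ((K.obj j).α g).hom :=
  IsLimit.conePointsIsoOfNatIso_hom_comp hc (isLimitOfPreserves (ρ.F g) hc) (diagramIso K g) j

theorem limitIso_proj_assoc (g : G) (j : J) {Z : A} (t : (ρ.F g).obj (K.obj j).obj ⟶ Z) :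
    (limitIso hc g).hom ≫ (ρ.F g).map (proj c j) ≫ t =
      proj c j ≫ ((K.obj j).α g).hom ≫ t := by
  rw [← Category.assoc, limitIso_proj, Category.assoc]

theorem proj_ext (hc : IsLimit c) (g : G) {Z : A} {a b : Z ⟶ (ρ.F g).obj c.pt}
    (h : ∀ j, a ≫ (ρ.F g).map (proj c j) = b ≫ (ρ.F g).map (proj c j)) : a = b :=
  (isLimitOfPreserves (ρ.F g) hc).hom_ext h

/-- The equivariant object on a limit. -/
noncomputable def limitObj : EquivariantObject ρ where
  obj := c.pt
  α := limitIso hc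
  α_mul g h := by
    apply proj_ext hc
    intro j
    have h1 := (ρ.ε g h).hom.naturality (proj c j)
    dsimp at h1
    rw [limitIso_proj, Category.assoc, Category.assoc, ← h1, ← Functor.map_comp_assoc,
      limitIso_proj, Functor.map_comp, Category.assoc, limitIso_proj_assoc,
      EquivariantObject.α_mul]

/-- The limit cone of equivariant objects. -/
noncomputable def limitCone : Cone K where
  pt := limitObj hc
  π :=
    { app := fun j => { hom := proj c j, comm := fun g => (limitIso_proj hc g j).symm }
      naturality := fun _ _ f => by ext; exact c.π.naturality f }

theorem lift_comm {X : EquivariantObject ρ} (t : X.obj ⟶ c.pt) (p : ∀ j, X ⟶ K.obj j)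
    (h : ∀ j, t ≫ proj c j = Hom.hom (p j)) (g : G) :
    t ≫ (limitIso hc g).hom = (X.α g).hom ≫ (ρ.F g).map t := by
  apply proj_ext hc
  intro j
  rw [Category.assoc, limitIso_proj, reassoc_of% (h j), Category.assoc, ← Functor.map_comp, h,
    Hom.comm (p j) g]

/-- It is a limit cone. -/
noncomputable def limitConeIsLimit : IsLimit (limitCone hc) where
  lift s :=
    { hom := (hc.lift ((forget ρ).mapCone s) : s.pt.obj ⟶ c.pt)
      comm := lift_comm hc _ s.π.app fun j => hc.fac ((forget ρ).mapCone s) j }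
  fac s j := by ext; exact hc.fac ((forget ρ).mapCone s) j
  uniq s m hm := by
    ext
    exact hc.uniq ((forget ρ).mapCone s) (Hom.hom m) fun j => congrArg Hom.hom (hm j)

end

noncomputable instance : CreatesLimit K (forget ρ) :=
  createsLimitOfReflectsIso fun _ hc =>
    { liftedCone := limitCone hc
      validLift := Iso.refl _
      makesLimit := limitConeIsLimit hc }

section

variable {K} {c : Cocone (K ⋙ forget ρ)} (hc : IsColimit c)

/-- The structure map `α_g` on a colimit. -/
noncomputable def colimitIso (g : G) : c.pt ≅ (ρ.F g).obj c.pt :=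
  IsColimit.coconePointsIsoOfNatIso hc (isColimitOfPreserves (ρ.F g) hc) (diagramIso K g)

/-- The injections of a cocone. -/
def inj (c : Cocone (K ⋙ forget ρ)) (j : J) : (K.obj j).obj ⟶ c.pt := c.ι.app j

theorem inj_colimitIso (g : G) (j : J) :
    inj c j ≫ (colimitIso hc g).hom = ((K.obj j).α g).hom ≫ (ρ.F g).map (inj c j) :=
  IsColimit.comp_coconePointsIsoOfNatIso_hom hc (isColimitOfPreserves (ρ.F g) hc)
    (diagramIso K g) j

theorem inj_colimitIso_assoc (g : G) (j : J) {Z : A} (t : (ρ.F g).obj c.pt ⟶ Z) :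
    inj c j ≫ (colimitIso hc g).hom ≫ t =
      ((K.obj j).α g).hom ≫ (ρ.F g).map (inj c j) ≫ t := by
  rw [← Category.assoc, inj_colimitIso, Category.assoc]

theorem inj_ext (hc : IsColimit c) {Z : A} {a b : c.pt ⟶ Z} (h : ∀ j, inj c j ≫ a = inj c j ≫ b) : a = b :=
  hc.hom_ext h

/-- The equivariant object on a colimit. -/
noncomputable def colimitObj : EquivariantObject ρ where
  obj := c.pt
  α := colimitIso hc
  α_mul g h := by
    apply inj_ext hc
    intro j
    have h1 := (ρ.ε g h).hom.naturality (inj c j)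
    dsimp at h1
    rw [inj_colimitIso, inj_colimitIso_assoc, ← Functor.map_comp_assoc, inj_colimitIso,
      Functor.map_comp, Category.assoc, h1, EquivariantObject.α_mul, Category.assoc,
      Category.assoc]

/-- The colimit cocone of equivariant objects. -/
noncomputable def colimitCocone : Cocone K where
  pt := colimitObj hc
  ι :=
    { app := fun j => { hom := inj c j, comm := fun g => inj_colimitIso hc g j }
      naturality := fun _ _ f => by ext; exact c.ι.naturality f }

theorem desc_comm {X : EquivariantObject ρ} (t : c.pt ⟶ X.obj) (p : ∀ j, K.obj j ⟶ X)
    (h : ∀ j, inj c j ≫ t = Hom.hom (p j)) (g : G) :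
    t ≫ (X.α g).hom = (colimitIso hc g).hom ≫ (ρ.F g).map t := by
  apply inj_ext hc
  intro j
  rw [reassoc_of% (h j), inj_colimitIso_assoc, ← Functor.map_comp, h, Hom.comm (p j) g]

/-- It is a colimit cocone. -/
noncomputable def colimitCoconeIsColimit : IsColimit (colimitCocone hc) where
  desc s :=
    { hom := (hc.desc ((forget ρ).mapCocone s) : c.pt ⟶ s.pt.obj)
      comm := desc_comm hc _ s.ι.app fun j => hc.fac ((forget ρ).mapCocone s) j }
  fac s j := by ext; exact hc.fac ((forget ρ).mapCocone s) j
  uniq s m hm := by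
    ext
    exact hc.uniq ((forget ρ).mapCocone s) (Hom.hom m) fun j => congrArg Hom.hom (hm j)

end

noncomputable instance : CreatesColimit K (forget ρ) :=
  createsColimitOfReflectsIso fun _ hc =>
    { liftedCocone := colimitCocone hc
      validLift := Iso.refl _
      makesColimit := colimitCoconeIsColimit hc }

end Limits

end EquivariantObject

end

section Abelian

variable {A : Type u} [Category.{v} A] [Abelian A] [Linear k A] {ρ : LinearAction k G A}

namespace EquivariantObject

noncomputable instance (J : Type*) [Category J] : CreatesLimitsOfShape J (forget ρ) where

noncomputable instance (J : Type*) [Category J] : CreatesColimitsOfShape J (forget ρ) where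

instance : HasFiniteLimits (EquivariantObject ρ) where
  out _ _ _ := hasLimitsOfShape_of_hasLimitsOfShape_createsLimitsOfShape (forget ρ)

instance : HasFiniteColimits (EquivariantObject ρ) where
  out _ _ _ := hasColimitsOfShape_of_hasColimitsOfShape_createsColimitsOfShape (forget ρ)

instance : PreservesFiniteLimits (forget ρ) where
  preservesFiniteLimits _ := inferInstance

instance : PreservesFiniteColimits (forget ρ) where
  preservesFiniteColimits _ := inferInstance

instance {X Y : EquivariantObject ρ} (f : X ⟶ Y) : IsIso (Abelian.coimageImageComparison f) :=
  have := IsIso.of_isIso_fac_right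
    (Abelian.PreservesCoimage.hom_coimageImageComparison (forget ρ) f).symm
  isIso_of_reflects_iso _ (forget ρ)

/-- The category of equivariant objects is abelian. -/
noncomputable instance : Abelian (EquivariantObject ρ) := Abelian.ofCoimageImageComparisonIsIso

end EquivariantObject

namespace SerreDuality

open EquivariantObject

variable {S : A ⥤ A} (D : SerreDuality k S)

variable (ρ) in
/-- The Serre functor `S^G` on equivariant objects:
`S^G(X, α) = (S X, α̃)` with `α̃_g = (σ_g)_X⁻¹ ∘ S(α_g)`, and `S^G(f) = S(f)`. -/
noncomputable def equivariantFunctor : EquivariantObject ρ ⥤ EquivariantObject ρ where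
  obj X :=
    { obj := S.obj X.obj
      α := fun g => S.mapIso (X.α g) ≪≫ ((D.commutator (ρ.F g)).app X.obj).symm
      α_mul := fun g h => by
        have h1 := D.commutator_comp (ρ.F (g * h)) (ρ.F g) (ρ.F h) (ρ.ε g h) X.obj
        have h2 := (D.commutator (ρ.F g)).inv.naturality (X.α h).hom
        dsimp at h1 h2 ⊢
        rw [← cancel_mono ((D.commutator (ρ.F (g * h))).hom.app X.obj)]
        simp only [Category.assoc, Functor.map_comp, h1]
        simp only [Iso.inv_hom_id_app, Functor.comp_obj, Category.comp_id]
        rw [X.α_mul, S.map_comp, S.map_comp, ← Functor.map_comp_assoc (ρ.F g)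
          ((D.commutator (ρ.F h)).inv.app X.obj)]
        simp only [Iso.inv_hom_id_app, Functor.comp_obj]
        rw [← reassoc_of% h2]
        simp }
  map {X Y} f :=
    { hom := S.map (Hom.hom f)
      comm := fun g => by
        have h2 := (D.commutator (ρ.F g)).inv.naturality (Hom.hom f)
        have h3 := Hom.comm f g
        dsimp at h2 ⊢
        rw [Category.assoc, ← h2, ← S.map_comp_assoc, ← S.map_comp_assoc, h3] }
  map_id X := by ext; exact S.map_id _
  map_comp f f' := by ext; exact S.map_comp _ _

variable (ρ) in
/-- The map `ψ : Hom((Y, β), S^G(X, α)) → D Ext¹((X, α), (Y, β))`,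
`ψ(f)([ξ]) = Tr_X(U(f.[ξ]))`. -/
noncomputable def psi (X Y : EquivariantObject ρ) :
    (Y ⟶ (D.equivariantFunctor ρ).obj X) →ₗ[k] Module.Dual k (Ext1 X Y) where
  toFun f :=
    D.trace X.obj ∘ₗ mapExt k (forget ρ) X ((D.equivariantFunctor ρ).obj X) ∘ₗ push k X f
  map_add' f f' := LinearMap.ext fun ξ =>
    (congrArg (D.trace X.obj ∘ₗ mapExt k (forget ρ) X ((D.equivariantFunctor ρ).obj X))
      (push_add f f' ξ)).trans (map_add _ _ _)
  map_smul' r f := LinearMap.ext fun ξ =>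
    (congrArg (D.trace X.obj ∘ₗ mapExt k (forget ρ) X ((D.equivariantFunctor ρ).obj X))
      (push_smul r f ξ)).trans (map_smul _ _ _)

end SerreDuality

end Abelian

end Action

end SerreEquivariant

open SerreEquivariant

namespace SerreEquivariant

/-! The proof is an averaging argument between $\mathcal A$ and $\mathcal A^G$. Induction $X \mapsto
\bigoplus_g F_g X$ is exact, and the maps $(\alpha_g)_g$ and $(\alpha_g^{-1})_g$ exhibit
$|G|\cdot\mathrm{id}$ of an equivariant object as a composite through the object induced from its
underlying object. Applying induction between these two maps gives transfers from the Hom and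
$\mathrm{Ext}^1$ spaces of $\mathcal A$ to those of $\mathcal A^G$; forgetting and then transferring
an extension class multiplies it by $|G|$ (`extTransfer_extForget`).

The defining property of the commutator isomorphisms says exactly that $\mathrm{Tr}_X$ is invariant
under the action twisted by $\alpha$ and $\tilde\alpha$ (`trace_invariant`). Hence transfer and
forgetting are adjoint for the trace pairings up to $|G|$: $\psi(f)(\mathrm{tr}\,\xi) =
|G|\,\mathrm{Tr}(Uf.\xi)$ and $\psi(\mathrm{tr}\,f)(\xi) = |G|\,\mathrm{Tr}(f.U\xi)$
(`psi_extTransfer`, `psi_transfer`). The first formula and nondegeneracy in $\mathcal A$ give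
injectivity of $\psi$. For surjectivity, a functional $u$ is composed with the transfer, represented
in $\mathcal A$ by some $f$, and recovered from $\psi(\mathrm{tr}\,f) = |G|^2 u$.

That $\mathbb S^G$ is an equivalence is independent of this: equivariant structures and morphisms
descend along the fully faithful, essentially surjective $\mathbb S$. -/

/-! ### Finite biproducts and additive functors. -/

/-- An additive functor preserves the identity $1 = \sum_j \pi_j\iota_j$ (composed in diagrammatic
order), so the images of the inclusions remain jointly epimorphic. This also covers composites such
as $F_g F_h$ without a choice of comparison isomorphism. -/
theorem hom_ext_map_biproduct_ι {C : Type u} [Category.{v} C] [Preadditive C]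
    {D : Type u'} [Category.{v'} D] [Preadditive D] (F : C ⥤ D) [F.Additive]
    {J : Type uG} [Finite J] (f : J → C) [HasBiproduct f] {Z : D} {a b : F.obj (⨁ f) ⟶ Z}
    (h : ∀ j, F.map (biproduct.ι f j) ≫ a = F.map (biproduct.ι f j) ≫ b) : a = b := by
  have := Fintype.ofFinite J
  rw [← Category.id_comp a, ← Category.id_comp b, ← F.map_id,
    ← IsBilimit.total (biproduct.isBilimit f), F.map_sum]
  simp only [Preadditive.sum_comp, Functor.map_comp, Category.assoc]
  exact Finset.sum_congr rfl fun j _ => congrArg (_ ≫ ·) (h j)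

theorem preservesBiproduct_of_additive {C : Type u} [Category.{v} C] [Preadditive C]
    {D : Type u'} [Category.{v'} D] [Preadditive D] (F : C ⥤ D) [F.Additive]
    {J : Type uG} [Finite J] (f : J → C) : PreservesBiproduct f F where
  preserves {b} hb := ⟨by
    have := Fintype.ofFinite J
    refine isBilimitOfTotal _ ?_
    refine Eq.trans ?_ ((congrArg F.map (IsBilimit.total hb)).trans (F.map_id _))
    rw [F.map_sum]
    exact Finset.sum_congr rfl fun j _ => (F.map_comp _ _).symm⟩

theorem biproduct_lift_eq_sum {C : Type u} [Category.{v} C] [Preadditive C]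
    {J : Type uG} [Fintype J] (f : J → C) [HasBiproduct f] {Z : C} (t : ∀ j, Z ⟶ f j) :
    biproduct.lift t = ∑ j, t j ≫ biproduct.ι f j := by
  rw [← Category.comp_id (biproduct.lift t)]
  refine (congrArg (biproduct.lift t ≫ ·) (IsBilimit.total (biproduct.isBilimit f)).symm).trans ?_
  refine (Preadditive.comp_sum _ _ _).trans (Finset.sum_congr rfl fun j _ => ?_)
  exact biproduct.lift_π_assoc _ _ _

/-- Absorbs the transport between $F_{(gh)l}$ and $F_{g(hl)}$ in the cocycle condition: inside the
biproduct both index the same summand. -/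
theorem eqToHom_app_comp_biproduct_ι {C : Type u} [Category.{v} C] [Preadditive C]
    {J : Type uG} (F : J → C ⥤ C) (X : C) [HasBiproduct fun j => (F j).obj X]
    {i j : J} (h : i = j) :
    (eqToHom (congrArg F h)).app X ≫ biproduct.ι (fun j => (F j).obj X) j =
      biproduct.ι (fun j => (F j).obj X) i := by
  subst h
  simp

/-! ### The induction functor. -/

namespace EquivariantObject

attribute [local instance] Abelian.hasFiniteBiproducts preservesBiproduct_of_additive

variable {k : Type uk} [Field k] {G : Type uG} [Group G] [Finite G]
  {A : Type u} [Category.{v} A] [Abelian A] [Linear k A] (ρ : LinearAction k G A)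

/-- The structure map of the induced object `⨁ g, F_g X`. -/
noncomputable def inducedIso (X : A) (h : G) :
    (⨁ fun g => (ρ.F g).obj X) ≅ (ρ.F h).obj (⨁ fun g => (ρ.F g).obj X) :=
  -- Left multiplication by $h$ permutes the summands, and $\varepsilon_{h,g}$ identifies $F_hF_gX$
  -- with the summand $F_{hg}X$.
  (biproduct.whiskerEquiv (f := fun g => (ρ.F h).obj ((ρ.F g).obj X))
    (g := fun g => (ρ.F g).obj X) (Equiv.mulLeft h) fun g => ((ρ.ε h g).app X).symm).symm ≪≫
    ((ρ.F h).mapBiproduct _).symm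

/-- The working description of the structure map. The inverse is used because maps out of
$F_h(\bigoplus_g F_gX)$ can be tested on summands. -/
theorem map_ι_inducedIso_inv (X : A) (h g : G) :
    (ρ.F h).map (biproduct.ι (fun g => (ρ.F g).obj X) g) ≫ (inducedIso ρ X h).inv =
      (ρ.ε h g).hom.app X ≫ biproduct.ι (fun g => (ρ.F g).obj X) (h * g) := by
  classical
  have h1 : (ρ.F h).map (biproduct.ι (fun g => (ρ.F g).obj X) g) ≫
      ((ρ.F h).mapBiproduct (fun g => (ρ.F g).obj X)).hom =
        biproduct.ι (fun g => (ρ.F h).obj ((ρ.F g).obj X)) g := by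
    have := Fintype.ofFinite G
    rw [← Iso.eq_comp_inv, Functor.mapBiproduct_inv, biproduct.ι_desc]
  simp only [inducedIso, Iso.trans_inv, Iso.symm_inv]
  refine (Category.assoc _ _ _).symm.trans ((congrArg (· ≫ _) h1).trans ?_)
  exact biproduct.ι_desc _ _

/-- The induced equivariant object `⨁ g, F_g X`. -/
noncomputable def inducedObj (X : A) : EquivariantObject ρ where
  obj := ⨁ fun g => (ρ.F g).obj X
  α := inducedIso ρ X
  α_mul g h := by
    -- The inverse form of the required identity; on the summand $l$ it becomes the cocycle
    -- condition for $g, h, l$.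
    have key : (ρ.ε g h).hom.app _ ≫ (inducedIso ρ X (g * h)).inv =
        (ρ.F g).map (inducedIso ρ X h).inv ≫ (inducedIso ρ X g).inv := by
      apply hom_ext_map_biproduct_ι (ρ.F h ⋙ ρ.F g)
      intro l
      have hn := (ρ.ε g h).hom.naturality (biproduct.ι (fun g => (ρ.F g).obj X) l)
      dsimp at hn ⊢
      rw [reassoc_of% hn, map_ι_inducedIso_inv, ← Functor.map_comp_assoc,
        map_ι_inducedIso_inv, Functor.map_comp, Category.assoc, map_ι_inducedIso_inv,
        ← reassoc_of% (ρ.cocycle g h l X)]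
      exact congrArg (fun t => (ρ.ε g h).hom.app _ ≫ (ρ.ε (g * h) l).hom.app X ≫ t)
        (eqToHom_app_comp_biproduct_ι ρ.F X (mul_assoc g h l)).symm
    rw [← cancel_mono (inducedIso ρ X (g * h)).inv, Iso.hom_inv_id, Category.assoc,
      Category.assoc, key, ← Functor.map_comp_assoc, Iso.hom_inv_id]
    simp

/-- The induction functor `X ↦ ⨁ g, F_g X`. -/
noncomputable def induction : A ⥤ EquivariantObject ρ where
  obj := inducedObj ρ
  map {X Y} f :=
    { hom := biproduct.map fun g => (ρ.F g).map f
      comm := fun h => by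
        have key : (inducedIso ρ X h).inv ≫ (biproduct.map fun g => (ρ.F g).map f) =
            (ρ.F h).map (biproduct.map fun g => (ρ.F g).map f) ≫ (inducedIso ρ Y h).inv := by
          apply hom_ext_map_biproduct_ι (ρ.F h)
          intro g
          have hn := (ρ.ε h g).hom.naturality f
          dsimp at hn
          rw [← Category.assoc, map_ι_inducedIso_inv, Category.assoc, biproduct.ι_map,
            ← Functor.map_comp_assoc, biproduct.ι_map, Functor.map_comp, Category.assoc,
            map_ι_inducedIso_inv, reassoc_of% hn]
        change (biproduct.map fun g => (ρ.F g).map f) ≫ (inducedIso ρ Y h).hom =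
          (inducedIso ρ X h).hom ≫ (ρ.F h).map (biproduct.map fun g => (ρ.F g).map f)
        rw [← Iso.inv_comp_eq, reassoc_of% key, Iso.inv_hom_id, Category.comp_id] }
  map_id X := by
    ext : 1
    change (biproduct.map fun g => (ρ.F g).map (𝟙 X)) = 𝟙 _
    ext; simp
  map_comp f f' := by
    ext : 1
    change (biproduct.map fun g => (ρ.F g).map (f ≫ f')) =
      (biproduct.map fun g => (ρ.F g).map f) ≫ biproduct.map fun g => (ρ.F g).map f'
    ext; simp

instance : (induction ρ).Additive where
  map_add {X Y f f'} := by
    ext : 1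
    change (biproduct.map fun g => (ρ.F g).map (f + f')) =
      (biproduct.map fun g => (ρ.F g).map f) + biproduct.map fun g => (ρ.F g).map f'
    ext; simp

instance : (induction ρ).Linear k where
  map_smul {X Y} f r := by
    ext : 1
    change (biproduct.map fun g => (ρ.F g).map (r • f)) =
      r • biproduct.map fun g => (ρ.F g).map f
    ext; simp

/-- The projection of the induced object onto a summand. -/
noncomputable def inductionπ (g : G) : induction ρ ⋙ forget ρ ⟶ ρ.F g where
  app X := biproduct.π (fun g => (ρ.F g).obj X) g
  naturality _ _ f := biproduct.map_π (fun g => (ρ.F g).map f) g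

/-- The inclusion of a summand into the induced object. -/
noncomputable def inductionι (g : G) : ρ.F g ⟶ induction ρ ⋙ forget ρ where
  app X := biproduct.ι (fun g => (ρ.F g).obj X) g
  naturality _ _ f := (biproduct.ι_map (fun g => (ρ.F g).map f) g).symm

theorem inductionπ_comp_inductionι [Fintype G] (X : A) :
    ∑ g, (inductionπ ρ g).app X ≫ (inductionι ρ g).app X = 𝟙 _ :=
  IsBilimit.total (biproduct.isBilimit fun g => (ρ.F g).obj X)

/-! ### Exactness of induction. -/

/-- The composite is a finite sum of the equivalences $F_g$, each of which preserves limits. A lift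
is assembled as the sum of its components through the $F_g$, and each component is forced by the
projection to that summand. -/
instance (J : Type*) [Category J] : PreservesLimitsOfShape J (induction ρ ⋙ forget ρ) where
  preservesLimit {K} := ⟨fun {c} hc => ⟨by
    have := Fintype.ofFinite G
    let s' (s : Cone (K ⋙ induction ρ ⋙ forget ρ)) (g : G) : Cone (K ⋙ ρ.F g) :=
      (Cone.postcompose (Functor.whiskerLeft K (inductionπ ρ g))).obj s
    have hl (g : G) : IsLimit ((ρ.F g).mapCone c) := isLimitOfPreserves (ρ.F g) hc
    exact
      { lift s := ∑ g, (hl g).lift (s' s g) ≫ (inductionι ρ g).app c.pt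
        fac s j := by
          have h1 (g : G) : ((hl g).lift (s' s g) ≫ (inductionι ρ g).app c.pt) ≫
              (induction ρ ⋙ forget ρ).map (c.π.app j) =
                s.π.app j ≫ (inductionπ ρ g).app _ ≫ (inductionι ρ g).app _ := by
            rw [Category.assoc, ← (inductionι ρ g).naturality, ← Category.assoc, ← Category.assoc]
            exact congrArg (· ≫ (inductionι ρ g).app _) ((hl g).fac (s' s g) j)
          refine (Preadditive.sum_comp _ _ _).trans ?_
          rw [Finset.sum_congr rfl fun g _ => h1 g, ← Preadditive.comp_sum,
            inductionπ_comp_inductionι]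
          exact Category.comp_id _
        uniq s m hm := by
          have h2 (g : G) : m ≫ (inductionπ ρ g).app c.pt = (hl g).lift (s' s g) :=
            (hl g).uniq (s' s g) _ fun j => by
              have h3 := (inductionπ ρ g).naturality (c.π.app j)
              refine (Category.assoc _ _ _).trans ?_
              refine (congrArg (m ≫ ·) h3.symm).trans ?_
              exact (Category.assoc _ _ _).symm.trans (congrArg (· ≫ _) (hm j))
          refine (Category.comp_id m).symm.trans ?_
          refine (congrArg (m ≫ ·) (inductionπ_comp_inductionι ρ c.pt).symm).trans ?_
          refine (Preadditive.comp_sum _ _ _).trans (Finset.sum_congr rfl fun g _ => ?_)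
          rw [← h2 g]
          exact (Category.assoc _ _ _).symm } ⟩⟩

instance (J : Type*) [Category J] : PreservesColimitsOfShape J (induction ρ ⋙ forget ρ) where
  preservesColimit {K} := ⟨fun {c} hc => ⟨by
    have := Fintype.ofFinite G
    let s' (s : Cocone (K ⋙ induction ρ ⋙ forget ρ)) (g : G) : Cocone (K ⋙ ρ.F g) :=
      (Cocone.precompose (Functor.whiskerLeft K (inductionι ρ g))).obj s
    have hl (g : G) : IsColimit ((ρ.F g).mapCocone c) := isColimitOfPreserves (ρ.F g) hc
    exact
      { desc s := ∑ g, (inductionπ ρ g).app c.pt ≫ (hl g).desc (s' s g)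
        fac s j := by
          have h1 (g : G) : (induction ρ ⋙ forget ρ).map (c.ι.app j) ≫
              (inductionπ ρ g).app c.pt ≫ (hl g).desc (s' s g) =
                ((inductionπ ρ g).app _ ≫ (inductionι ρ g).app _) ≫ s.ι.app j := by
            refine (Category.assoc _ _ _).symm.trans ?_
            refine (congrArg (· ≫ _) ((inductionπ ρ g).naturality (c.ι.app j))).trans ?_
            refine (Category.assoc _ _ _).trans (Eq.trans ?_ (Category.assoc _ _ _).symm)
            exact congrArg ((inductionπ ρ g).app _ ≫ ·) ((hl g).fac (s' s g) j)
          refine (Preadditive.comp_sum _ _ _).trans ?_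
          rw [Finset.sum_congr rfl fun g _ => h1 g, ← Preadditive.sum_comp,
            inductionπ_comp_inductionι]
          exact Category.id_comp _
        uniq s m hm := by
          have h2 (g : G) : (inductionι ρ g).app c.pt ≫ m = (hl g).desc (s' s g) :=
            (hl g).uniq (s' s g) _ fun j => by
              have h3 := (inductionι ρ g).naturality (c.ι.app j)
              refine (Category.assoc _ _ _).symm.trans ?_
              refine (congrArg (· ≫ m) h3).trans ?_
              exact (Category.assoc _ _ _).trans (congrArg (_ ≫ ·) (hm j))
          refine (Category.id_comp m).symm.trans ?_
          refine (congrArg (· ≫ m) (inductionπ_comp_inductionι ρ c.pt).symm).trans ?_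
          refine (Preadditive.sum_comp _ _ _).trans (Finset.sum_congr rfl fun g _ => ?_)
          rw [← h2 g]
          exact Category.assoc _ _ _ } ⟩⟩

/-- Exactness can be checked after forgetting, since the forgetful functor reflects limits and
colimits. -/
instance : PreservesFiniteLimits (induction ρ) where
  preservesFiniteLimits _ _ _ := preservesLimitsOfShape_of_reflects_of_preserves _ (forget ρ)

instance : PreservesFiniteColimits (induction ρ) where
  preservesFiniteColimits _ _ _ := preservesColimitsOfShape_of_reflects_of_preserves _ (forget ρ)

instance : PreservesFiniteLimits (induction ρ ⋙ forget ρ) where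
  preservesFiniteLimits _ _ _ := inferInstance

instance : PreservesFiniteColimits (induction ρ ⋙ forget ρ) where
  preservesFiniteColimits _ _ _ := inferInstance

/-! ### Unit, counit and transfer of morphisms. -/

/-- The morphism `(α_g)_g : X ⟶ ⨁ g, F_g X`. -/
noncomputable def inductionUnit : 𝟭 (EquivariantObject ρ) ⟶ forget ρ ⋙ induction ρ where
  app X :=
    { hom := biproduct.lift fun g => (X.α g).hom
      comm := fun h => by
        change (biproduct.lift fun g => (X.α g).hom) ≫ (inducedIso ρ X.obj h).hom =
          (X.α h).hom ≫ (ρ.F h).map (biproduct.lift fun g => (X.α g).hom)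
        have := Fintype.ofFinite G
        -- With the structure map moved across as its inverse, both sides are sums over $G$;
        -- reindexing by $g \mapsto hg$ makes them agree termwise by `α_mul`.
        rw [← Iso.eq_comp_inv, biproduct_lift_eq_sum, Functor.map_sum, Category.assoc,
          Preadditive.sum_comp, Preadditive.comp_sum, ← Equiv.sum_comp (Equiv.mulLeft h)]
        refine Finset.sum_congr rfl fun g _ => ?_
        rw [Functor.map_comp, Category.assoc, map_ι_inducedIso_inv, Equiv.coe_mulLeft, X.α_mul,
          Category.assoc, Category.assoc] }
  naturality X Y f := by
    ext : 1
    change Hom.hom f ≫ (biproduct.lift fun g => (Y.α g).hom) =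
      (biproduct.lift fun g => (X.α g).hom) ≫ biproduct.map fun g => (ρ.F g).map (Hom.hom f)
    ext g
    simp [Hom.comm f g]

/-- The morphism `(α_g⁻¹)_g : ⨁ g, F_g X ⟶ X`. -/
noncomputable def inductionCounit : forget ρ ⋙ induction ρ ⟶ 𝟭 (EquivariantObject ρ) where
  app X :=
    { hom := biproduct.desc fun g => (X.α g).inv
      comm := fun h => by
        change (biproduct.desc fun g => (X.α g).inv) ≫ (X.α h).hom =
          (inducedIso ρ X.obj h).hom ≫ (ρ.F h).map (biproduct.desc fun g => (X.α g).inv)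
        rw [← Iso.inv_comp_eq]
        apply hom_ext_map_biproduct_ι (ρ.F h)
        intro g
        -- On the summand $g$ the claim is the inverted form of `α_mul` for the pair $h, g$.
        rw [reassoc_of% (map_ι_inducedIso_inv ρ X.obj h g), biproduct.ι_desc_assoc,
          ← Functor.map_comp, biproduct.ι_desc, ← cancel_mono (X.α h).inv, Category.assoc,
          Category.assoc, Iso.hom_inv_id, Category.comp_id, ← cancel_mono (X.α (h * g)).hom,
          Category.assoc, Iso.inv_hom_id, X.α_mul, Category.assoc, Iso.inv_hom_id_assoc,
          ← Functor.map_comp_assoc, Iso.inv_hom_id]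
        simp }
  naturality X Y f := by
    ext : 1
    change (biproduct.map fun g => (ρ.F g).map (Hom.hom f)) ≫
        (biproduct.desc fun g => (Y.α g).inv) = (biproduct.desc fun g => (X.α g).inv) ≫ Hom.hom f
    ext g
    have := Hom.comm f g
    simp [Iso.eq_inv_comp, ← reassoc_of% this]

variable {ρ}

theorem inductionUnit_app_hom [Fintype G] (X : EquivariantObject ρ) :
    Hom.hom ((inductionUnit ρ).app X) = ∑ g, (X.α g).hom ≫ (inductionι ρ g).app X.obj :=
  biproduct_lift_eq_sum _ _

theorem inductionι_comp_inductionCounit (X : EquivariantObject ρ) (g : G) :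
    (inductionι ρ g).app X.obj ≫ Hom.hom ((inductionCounit ρ).app X) = (X.α g).inv :=
  biproduct.ι_desc _ _

/-- Each summand contributes $\alpha_g^{-1}\alpha_g = 1$. -/
theorem inductionUnit_comp_inductionCounit (X : EquivariantObject ρ) :
    (inductionUnit ρ).app X ≫ (inductionCounit ρ).app X = (Nat.card G : k) • 𝟙 X := by
  have := Fintype.ofFinite G
  ext : 1
  change (biproduct.lift fun g => (X.α g).hom) ≫ (biproduct.desc fun g => (X.α g).inv) =
    (Nat.card G : k) • 𝟙 X.obj
  rw [biproduct_lift_eq_sum, Preadditive.sum_comp]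
  simp [Nat.cast_smul_eq_nsmul]

/-- The equivariant morphism `∑ g, α_g ≫ F_g f ≫ β_g⁻¹` obtained from a morphism `f` of the
underlying objects. -/
noncomputable def homTransfer {X Y : EquivariantObject ρ} (f : X.obj ⟶ Y.obj) : X ⟶ Y :=
  (inductionUnit ρ).app X ≫ (induction ρ).map f ≫ (inductionCounit ρ).app Y

theorem homTransfer_hom [Fintype G] {X Y : EquivariantObject ρ} (f : X.obj ⟶ Y.obj) :
    Hom.hom (homTransfer f) = ∑ g, (X.α g).hom ≫ (ρ.F g).map f ≫ (Y.α g).inv := by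
  change (biproduct.lift fun g => (X.α g).hom) ≫ (biproduct.map fun g => (ρ.F g).map f) ≫
    (biproduct.desc fun g => (Y.α g).inv) = _
  rw [biproduct_lift_eq_sum, Preadditive.sum_comp]
  simp

end EquivariantObject

-- Additivity of pull-back and push-out in the morphism.

attribute [local instance] HasExt.standard in
theorem pull_add {k : Type uk} [Field k] {C : Type u} [Category.{v} C] [Abelian C] [Linear k C]
    {X X' Y : C} (f f' : X' ⟶ X) (ξ : Ext1 X Y) :
    pull k (f + f') Y ξ = pull k f Y ξ + pull k f' Y ξ := by
  simp [pull, Ext.mk₀_add]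

attribute [local instance] HasExt.standard in
theorem pull_smul {k : Type uk} [Field k] {C : Type u} [Category.{v} C] [Abelian C] [Linear k C]
    {X X' Y : C} (r : k) (f : X' ⟶ X) (ξ : Ext1 X Y) :
    pull k (r • f) Y ξ = r • pull k f Y ξ := by
  simp [pull, Ext.mk₀_smul]

theorem pull_sum {k : Type uk} [Field k] {C : Type u} [Category.{v} C] [Abelian C] [Linear k C]
    {X X' Y : C} {J : Type uG} (s : Finset J) (f : J → (X' ⟶ X)) (ξ : Ext1 X Y) :
    pull k (∑ j ∈ s, f j) Y ξ = ∑ j ∈ s, pull k (f j) Y ξ := by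
  classical
  induction s using Finset.induction_on with
  -- The zero morphism acts as zero because it equals $0 \cdot 0$.
  | empty => simpa using pull_smul (0 : k) (0 : X' ⟶ X) ξ
  | insert j s hj ih => rw [Finset.sum_insert hj, Finset.sum_insert hj, pull_add, ih]

theorem push_sum {k : Type uk} [Field k] {C : Type u} [Category.{v} C] [Abelian C] [Linear k C]
    {X Y Y' : C} {J : Type uG} (s : Finset J) (f : J → (Y ⟶ Y')) (ξ : Ext1 X Y) :
    push k X (∑ j ∈ s, f j) ξ = ∑ j ∈ s, push k X (f j) ξ := by
  classical
  induction s using Finset.induction_on with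
  | empty => simpa using push_smul (0 : k) (0 : Y ⟶ Y') ξ
  | insert j s hj ih => rw [Finset.sum_insert hj, Finset.sum_insert hj, push_add, ih]

/-! ### Forgetting and transferring extension classes. -/

namespace EquivariantObject

variable {k : Type uk} [Field k] {G : Type uG} [Group G]
  {A : Type u} [Category.{v} A] [Abelian A] [Linear k A] {ρ : LinearAction k G A}

/-- The forgetful map on extension classes. -/
noncomputable def extForget (X Y : EquivariantObject ρ) : Ext1 X Y →ₗ[k] Ext1 X.obj Y.obj :=
  mapExt k (forget ρ) X Y

theorem extForget_push (X : EquivariantObject ρ) {Y Y' : EquivariantObject ρ} (f : Y ⟶ Y')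
    (ξ : Ext1 X Y) :
    extForget X Y' (push k X f ξ) = push k X.obj (Hom.hom f) (extForget X Y ξ) :=
  mapExt_push (forget ρ) f ξ

theorem extForget_pull {X X' : EquivariantObject ρ} (f : X' ⟶ X) (Y : EquivariantObject ρ)
    (ξ : Ext1 X Y) :
    extForget X' Y (pull k f Y ξ) = pull k (Hom.hom f) Y.obj (extForget X Y ξ) :=
  mapExt_pull (forget ρ) f ξ

/-- The structure maps `α_g` as a natural transformation. -/
def structureMap (ρ : LinearAction k G A) (g : G) : forget ρ ⟶ forget ρ ⋙ ρ.F g where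
  app X := (X.α g).hom
  naturality _ _ f := Hom.comm f g

/-- Extension classes of equivariant objects are invariant. -/
theorem push_extForget {X Y : EquivariantObject ρ} (g : G) (ξ : Ext1 X Y) :
    push k X.obj (Y.α g).hom (extForget X Y ξ) =
      pull k (X.α g).hom _ (mapExt k (ρ.F g) X.obj Y.obj (extForget X Y ξ)) :=
  (mapExt_naturality _ _ (structureMap ρ g) ξ).trans
    (congrArg _ (mapExt_comp (forget ρ) (ρ.F g) ξ))

variable [Finite G]

/-- The morphism `(α_g)_g` with values in the induced object. -/
noncomputable def toInduction (X : EquivariantObject ρ) : X ⟶ (induction ρ).obj X.obj :=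
  (inductionUnit ρ).app X

/-- The morphism `(α_g⁻¹)_g` from the induced object. -/
noncomputable def fromInduction (X : EquivariantObject ρ) : (induction ρ).obj X.obj ⟶ X :=
  (inductionCounit ρ).app X

/-- The equivariant extension class `∑ g, β_g⁻¹.F_g(ξ).α_g` obtained from an extension class `ξ`
of the underlying objects. -/
noncomputable def extTransfer (X Y : EquivariantObject ρ) : Ext1 X.obj Y.obj →ₗ[k] Ext1 X Y :=
  push k X (fromInduction Y) ∘ₗ pull k (toInduction X) _ ∘ₗ mapExt k (induction ρ) X.obj Y.obj

/-- Expanding the unit as a sum over summand inclusions $F_g \to U\,\mathrm{Ind}$, naturality of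
each inclusion trades the class of $U\,\mathrm{Ind}(\xi)$ for that of $F_g(\xi)$, and the counit
restricts to $\beta_g^{-1}$. -/
theorem extForget_extTransfer [Fintype G] {X Y : EquivariantObject ρ} (ξ : Ext1 X.obj Y.obj) :
    extForget X Y (extTransfer X Y ξ) =
      ∑ g, push k X.obj (Y.α g).inv (pull k (X.α g).hom _ (mapExt k (ρ.F g) X.obj Y.obj ξ)) := by
  let a : X.obj ⟶ (induction ρ ⋙ forget ρ).obj X.obj := Hom.hom (toInduction X)
  let b : (induction ρ ⋙ forget ρ).obj Y.obj ⟶ Y.obj := Hom.hom (fromInduction Y)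
  have h1 : extForget X Y (extTransfer X Y ξ) =
      push k X.obj b (pull k a _ (mapExt k (induction ρ ⋙ forget ρ) X.obj Y.obj ξ)) := by
    refine (extForget_push X _ _).trans (congrArg _ ?_)
    refine (extForget_pull _ _ _).trans (congrArg _ ?_)
    exact (mapExt_comp (induction ρ) (forget ρ) ξ).symm
  have ha : a = ∑ g, (X.α g).hom ≫ (inductionι ρ g).app X.obj := inductionUnit_app_hom X
  have hb (g : G) : (inductionι ρ g).app Y.obj ≫ b = (Y.α g).inv :=
    inductionι_comp_inductionCounit Y g
  rw [h1, ha, pull_sum, map_sum]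
  refine Finset.sum_congr rfl fun g _ => ?_
  have h2 := mapExt_naturality (k := k) _ _ (inductionι ρ g) ξ
  rw [pull_comp, ← h2, pull_push, ← hb, push_comp]

/-- Naturality of the counit turns the push-out along it into a pull-back, where it meets the unit
and the composite is $|G|$. -/
theorem extTransfer_extForget {X Y : EquivariantObject ρ} (ξ : Ext1 X Y) :
    extTransfer X Y (extForget X Y ξ) = (Nat.card G : k) • ξ := by
  have h : push k ((induction ρ).obj X.obj) (fromInduction Y)
      (mapExt k (induction ρ) X.obj Y.obj (extForget X Y ξ)) = pull k (fromInduction X) Y ξ := by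
    refine Eq.trans (congrArg _ (mapExt_comp (forget ρ) (induction ρ) ξ).symm) ?_
    refine (mapExt_naturality (k := k) _ _ (inductionCounit ρ) ξ).trans ?_
    exact congrArg _ (mapExt_id ξ)
  have h' : toInduction X ≫ fromInduction X = (Nat.card G : k) • 𝟙 X :=
    inductionUnit_comp_inductionCounit X
  change push k X (fromInduction Y) (pull k (toInduction X) _
    (mapExt k (induction ρ) X.obj Y.obj (extForget X Y ξ))) = _
  rw [← pull_push, h, ← pull_comp, h', pull_smul, pull_id]

end EquivariantObject

/-! ### The trace pairing on equivariant objects. -/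

namespace SerreDuality

open EquivariantObject

variable {k : Type uk} [Field k] {G : Type uG} [Group G]
  {A : Type u} [Category.{v} A] [Abelian A] [Linear k A] {ρ : LinearAction k G A}
  {S : A ⥤ A} (D : SerreDuality k S)

/-- The underlying morphism of a morphism to `S^G(X, α)`. -/
def underlying {X Y : EquivariantObject ρ} (f : Y ⟶ (D.equivariantFunctor ρ).obj X) :
    Y.obj ⟶ S.obj X.obj := Hom.hom f

/-- The inverse structure map of `S^G(X, α)`. -/
noncomputable def structureInv (X : EquivariantObject ρ) (g : G) :
    (ρ.F g).obj (S.obj X.obj) ⟶ S.obj X.obj :=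
  (show (ρ.F g).obj (S.obj X.obj) ⟶ S.obj ((ρ.F g).obj X.obj) from
    (D.commutator (ρ.F g)).hom.app X.obj) ≫ S.map (X.α g).inv

/-- Equivariance with the structure maps inverted, matching the factors $\beta_g^{-1}$ in
`extForget_extTransfer`. -/
theorem underlying_comm {X Y : EquivariantObject ρ} (f : Y ⟶ (D.equivariantFunctor ρ).obj X)
    (g : G) : (Y.α g).inv ≫ D.underlying f = (ρ.F g).map (D.underlying f) ≫ D.structureInv X g := by
  have h := Hom.comm f g
  rw [← Iso.eq_comp_inv, Category.assoc, ← Iso.inv_comp_eq] at h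
  exact h

theorem psi_apply {X Y : EquivariantObject ρ} (f : Y ⟶ (D.equivariantFunctor ρ).obj X)
    (ξ : Ext1 X Y) :
    D.psi ρ X Y f ξ = D.trace X.obj (push k X.obj (D.underlying f) (extForget X Y ξ)) :=
  congrArg (D.trace X.obj) (extForget_push X f ξ)

/-- The trace map is invariant. -/
theorem trace_invariant (X : EquivariantObject ρ) (g : G) (ζ : Ext1 X.obj (S.obj X.obj)) :
    D.trace X.obj (push k X.obj (D.structureInv X g)
      (pull k (X.α g).hom _ (mapExt k (ρ.F g) X.obj (S.obj X.obj) ζ))) = D.trace X.obj ζ := by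
  -- The commutator property moves the right-hand trace to $F_gX$. On the left, the pull-back along
  -- $\alpha_g$ becomes a push-out along $\mathbb S(\alpha_g)$, which cancels $\mathbb
  -- S(\alpha_g^{-1})$.
  rw [D.isCommutator_commutator (ρ.F g) X.obj ζ, ← pull_push, D.trace_pull, ← push_comp,
    structureInv, Category.assoc, ← S.map_comp, Iso.inv_hom_id, S.map_id, Category.comp_id]

/-- Invariance of the trace applied to $f.\xi$; it makes all $|G|$ terms of a transferred sum equal.
-/
theorem trace_push_conj {X Y : EquivariantObject ρ} (g : G) (f : Y.obj ⟶ S.obj X.obj)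
    (ξ : Ext1 X.obj Y.obj) :
    D.trace X.obj (push k X.obj ((ρ.F g).map f ≫ D.structureInv X g)
      (pull k (X.α g).hom _ (mapExt k (ρ.F g) X.obj Y.obj ξ))) =
        D.trace X.obj (push k X.obj f ξ) := by
  rw [← D.trace_invariant X g (push k X.obj f ξ), mapExt_push, pull_push, push_comp]

theorem psi_natural_left {X X' : EquivariantObject ρ} (f : X ⟶ X') (Y : EquivariantObject ρ)
    (t : Y ⟶ (D.equivariantFunctor ρ).obj X) :
    D.psi ρ X' Y (t ≫ (D.equivariantFunctor ρ).map f) = D.psi ρ X Y t ∘ₗ pull k f Y := by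
  refine LinearMap.ext fun ξ => ?_
  rw [LinearMap.comp_apply, psi_apply, psi_apply, extForget_pull, ← pull_push, trace_pull]
  exact congrArg _ (push_comp _ _ _)

theorem psi_natural_right (X : EquivariantObject ρ) {Y Y' : EquivariantObject ρ} (g : Y ⟶ Y')
    (t : Y' ⟶ (D.equivariantFunctor ρ).obj X) :
    D.psi ρ X Y (g ≫ t) = D.psi ρ X Y' t ∘ₗ push k X g := by
  refine LinearMap.ext fun ξ => ?_
  rw [LinearMap.comp_apply, psi_apply, psi_apply, extForget_push]
  exact congrArg _ (push_comp _ _ _)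

variable [Finite G]

/-- Equivariance of $f$ carries it past each $\beta_g^{-1}$, after which every term has the same
trace. -/
theorem psi_extTransfer {X Y : EquivariantObject ρ}
    (f : Y ⟶ (D.equivariantFunctor ρ).obj X) (ξ : Ext1 X.obj Y.obj) :
    D.psi ρ X Y f (extTransfer X Y ξ) =
      (Nat.card G : k) * D.trace X.obj (push k X.obj (D.underlying f) ξ) := by
  have := Fintype.ofFinite G
  rw [psi_apply, extForget_extTransfer, map_sum, map_sum]
  simp only [← push_comp, underlying_comm, trace_push_conj]
  simp

/-- The morphism to `S^G(X, α)` obtained from a morphism to `S X`. -/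
noncomputable def transfer {X Y : EquivariantObject ρ} (f : Y.obj ⟶ S.obj X.obj) :
    Y ⟶ (D.equivariantFunctor ρ).obj X :=
  homTransfer (Y := (D.equivariantFunctor ρ).obj X) f

theorem underlying_transfer [Fintype G] {X Y : EquivariantObject ρ} (f : Y.obj ⟶ S.obj X.obj) :
    D.underlying (D.transfer f) = ∑ g, (Y.α g).hom ≫ (ρ.F g).map f ≫ D.structureInv X g :=
  homTransfer_hom (Y := (D.equivariantFunctor ρ).obj X) f

/-- Here it is the invariance of the class $U\xi$ (`push_extForget`) that brings each term into the
conjugated form. -/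
theorem psi_transfer {X Y : EquivariantObject ρ} (f : Y.obj ⟶ S.obj X.obj) (ξ : Ext1 X Y) :
    D.psi ρ X Y (D.transfer f) ξ =
      (Nat.card G : k) * D.trace X.obj (push k X.obj f (extForget X Y ξ)) := by
  have := Fintype.ofFinite G
  rw [psi_apply, underlying_transfer, push_sum, map_sum]
  have h (g : G) : D.trace X.obj (push k X.obj ((Y.α g).hom ≫ (ρ.F g).map f ≫
      D.structureInv X g) (extForget X Y ξ)) =
        D.trace X.obj (push k X.obj f (extForget X Y ξ)) := by
    rw [push_comp, push_extForget, trace_push_conj]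
  simp [h]

theorem psi_bijective (hG : (Nat.card G : k) ≠ 0) (X Y : EquivariantObject ρ) :
    Function.Bijective (D.psi ρ X Y) := by
  constructor
  · rw [← LinearMap.ker_eq_bot, LinearMap.ker_eq_bot']
    intro f hf
    have h0 : D.underlying f = 0 := by
      -- Nondegeneracy in $\mathcal A$: $\psi(f)$ is evaluated on transfers of arbitrary classes,
      -- and $|G|$ is cancelled.
      apply D.hom_ext
      intro ξ
      have h := D.psi_extTransfer f ξ
      rw [hf, LinearMap.zero_apply] at h
      rw [(mul_eq_zero.1 h.symm).resolve_left hG, D.trace_push, map_zero, LinearMap.zero_apply]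
    ext : 1
    exact h0
  · intro u
    -- One factor $|G|^{-1}$ compensates `psi_transfer`, the other `extTransfer_extForget`.
    refine ⟨((Nat.card G : k)⁻¹ * (Nat.card G : k)⁻¹) •
      D.transfer (D.φ X.obj Y.obj (u ∘ₗ extTransfer X Y)), ?_⟩
    refine LinearMap.ext fun ξ => ?_
    rw [map_smul, LinearMap.smul_apply, psi_transfer, D.trace_push,
      LinearEquiv.symm_apply_apply, LinearMap.comp_apply, extTransfer_extForget, map_smul]
    simp only [smul_eq_mul]
    field_simp

end SerreDuality

/-! ### The functor $\mathbb S^G$ is a linear equivalence. -/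

namespace SerreDuality

open EquivariantObject

variable {k : Type uk} [Field k] {G : Type uG} [Group G]
  {A : Type u} [Category.{v} A] [Abelian A] [Linear k A] (ρ : LinearAction k G A)
  {S : A ⥤ A} (D : SerreDuality k S)

theorem equivariantFunctor_additive : (D.equivariantFunctor ρ).Additive where
  map_add {X Y f f'} := by
    have := D.additive
    ext : 1
    exact S.map_add (f := Hom.hom f) (g := Hom.hom f')

theorem equivariantFunctor_linear : (D.equivariantFunctor ρ).Linear k where
  map_smul {X Y} f r := by
    have := D.linear
    ext : 1
    exact Functor.Linear.map_smul (F := S) (Hom.hom f) r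

theorem equivariantFunctor_faithful : (D.equivariantFunctor ρ).Faithful where
  map_injective {X Y f f'} h := by
    have := D.isEquivalence
    ext : 1
    exact S.map_injective (congrArg Hom.hom h)

theorem equivariantFunctor_full : (D.equivariantFunctor ρ).Full where
  map_surjective {X Y} f := by
    have := D.isEquivalence
    let f' : S.obj X.obj ⟶ S.obj Y.obj := Hom.hom f
    obtain ⟨t, ht⟩ := S.map_surjective f'
    -- The preimage under $\mathbb S$ is itself equivariant: after applying $\mathbb S$, naturality
    -- of $\sigma_g^{-1}$ allows it to be cancelled.
    have hc (g : G) : t ≫ (Y.α g).hom = (X.α g).hom ≫ (ρ.F g).map t := by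
      apply S.map_injective
      have h1 : f' ≫ S.map (Y.α g).hom ≫ (D.commutator (ρ.F g)).inv.app Y.obj =
          (S.map (X.α g).hom ≫ (D.commutator (ρ.F g)).inv.app X.obj) ≫
            (ρ.F g).map (f') := Hom.comm f g
      have h2 := (D.commutator (ρ.F g)).inv.naturality t
      dsimp at h2
      rw [← ht, Category.assoc, ← h2, ← S.map_comp_assoc, ← S.map_comp_assoc] at h1
      exact (cancel_mono _).1 h1
    refine ⟨{ hom := t, comm := hc }, ?_⟩
    ext : 1
    exact ht

theorem equivariantFunctor_essSurj : (D.equivariantFunctor ρ).EssSurj where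
  mem_essImage Z := by
    have := D.isEquivalence
    let e := S.objObjPreimageIso Z.obj
    -- The unique choice for which $e$ is equivariant: $\mathbb S(\alpha_g)$ is prescribed, and
    -- $\mathbb S$ is fully faithful.
    let α (g : G) : S.objPreimage Z.obj ≅ (ρ.F g).obj (S.objPreimage Z.obj) :=
      S.preimageIso (e ≪≫ Z.α g ≪≫ (ρ.F g).mapIso e.symm ≪≫ (D.commutator (ρ.F g)).app _)
    have hα (g : G) : S.map (α g).hom = e.hom ≫ (Z.α g).hom ≫ (ρ.F g).map e.inv ≫
        (D.commutator (ρ.F g)).hom.app (S.objPreimage Z.obj) := by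
      simp [α]
    let X : EquivariantObject ρ :=
      { obj := S.objPreimage Z.obj
        α := α
        α_mul := fun g h => by
          -- After applying $\mathbb S$, the law follows from the one for $Z$ and the compatibility
          -- of commutators with composition, `commutator_comp`.
          apply S.map_injective
          have h1 := D.commutator_comp (ρ.F (g * h)) (ρ.F g) (ρ.F h) (ρ.ε g h)
            (S.objPreimage Z.obj)
          have h2 := (D.commutator (ρ.F g)).hom.naturality (α h).hom
          have h3 := (ρ.ε g h).hom.naturality e.inv
          dsimp at h1 h2 h3
          rw [S.map_comp, S.map_comp, hα g]
          simp only [Category.assoc]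
          rw [← reassoc_of% h2, hα h, hα (g * h), Z.α_mul]
          simp only [Functor.map_comp, Category.assoc]
          rw [← h1, ← Functor.map_comp_assoc (ρ.F g) e.inv, Iso.inv_hom_id,
            CategoryTheory.Functor.map_id, Category.id_comp, reassoc_of% h3] }
    let t : (D.equivariantFunctor ρ).obj X ⟶ Z :=
      { hom := e.hom
        comm := fun g => by
          change e.hom ≫ (Z.α g).hom =
            (S.map (α g).hom ≫ (D.commutator (ρ.F g)).inv.app _) ≫ (ρ.F g).map e.hom
          rw [hα]
          simp [← Functor.map_comp] }
    have ht : IsIso ((forget ρ).map t) := inferInstanceAs (IsIso e.hom)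
    have : IsIso t := isIso_of_reflects_iso t (forget ρ)
    exact ⟨X, ⟨asIso t⟩⟩

theorem equivariantFunctor_isEquivalence : (D.equivariantFunctor ρ).IsEquivalence where
  faithful := D.equivariantFunctor_faithful ρ
  full := D.equivariantFunctor_full ρ
  essSurj := D.equivariantFunctor_essSurj ρ

variable [Finite G]

/-- The Serre duality of the category of equivariant objects. -/
noncomputable def equivariant (hG : (Nat.card G : k) ≠ 0) :
    SerreDuality k (D.equivariantFunctor ρ) where
  isEquivalence := D.equivariantFunctor_isEquivalence ρ
  additive := D.equivariantFunctor_additive ρ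
  linear := D.equivariantFunctor_linear ρ
  φ X Y := (LinearEquiv.ofBijective (D.psi ρ X Y) (D.psi_bijective hG X Y)).symm
  natural_left {X X'} f Y u := by
    rw [LinearEquiv.symm_apply_eq, LinearEquiv.ofBijective_apply, psi_natural_left,
      ← LinearEquiv.ofBijective_apply (hf := D.psi_bijective hG X Y),
      LinearEquiv.apply_symm_apply]
  natural_right X {Y Y'} g u := by
    rw [LinearEquiv.symm_apply_eq, LinearEquiv.ofBijective_apply, psi_natural_right,
      ← LinearEquiv.ofBijective_apply (hf := D.psi_bijective hG X Y'),
      LinearEquiv.apply_symm_apply]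

end SerreDuality

/-! ### Hom-finiteness and the final statement. -/

theorem EquivariantObject.finite_hom {k : Type uk} [Field k] {G : Type uG} [Group G]
    {A : Type u} [Category.{v} A] [Preadditive A] [Linear k A] {ρ : LinearAction k G A}
    [∀ X Y : A, Module.Finite k (X ⟶ Y)] (X Y : EquivariantObject ρ) :
    Module.Finite k (X ⟶ Y) :=
  Module.Finite.of_injective
    (⟨⟨fun f => Hom.hom f, fun _ _ => rfl⟩, fun _ _ => rfl⟩ : (X ⟶ Y) →ₗ[k] (X.obj ⟶ Y.obj))
    fun _ _ h => EquivariantObject.hom_ext h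

end SerreEquivariant

/-- The Serre duality of the category of equivariant objects. -/
theorem theorem3p5 {k : Type uk} [Field k] {A : Type u} [Category.{v} A] [Abelian A] [Linear k A]
    [∀ X Y : A, Module.Finite k (X ⟶ Y)]
    {G : Type uG} [Group G] [Finite G] (hG : (Nat.card G : k) ≠ 0)
    (ρ : LinearAction k G A) {S : A ⥤ A} (D : SerreDuality k S) :
    -- `ψ` is natural in `(X, α)`, natural in `(Y, β)`, and an isomorphism
    (∀ {X X' : EquivariantObject ρ} (f : X ⟶ X') (Y : EquivariantObject ρ)
        (t : Y ⟶ (D.equivariantFunctor ρ).obj X),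
      D.psi ρ X' Y (t ≫ (D.equivariantFunctor ρ).map f) = D.psi ρ X Y t ∘ₗ pull k f Y) ∧
    (∀ (X : EquivariantObject ρ) {Y Y' : EquivariantObject ρ} (g : Y ⟶ Y')
        (t : Y' ⟶ (D.equivariantFunctor ρ).obj X),
      D.psi ρ X Y (g ≫ t) = D.psi ρ X Y' t ∘ₗ push k X g) ∧
    (∀ X Y : EquivariantObject ρ, Function.Bijective (D.psi ρ X Y)) ∧
    -- `A^G` is Hom-finite and `ψ⁻¹` is a Serre duality on it, with Serre functor `S^G`
    (∀ X Y : EquivariantObject ρ, Module.Finite k (X ⟶ Y)) ∧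
    ∃ E : SerreDuality k (D.equivariantFunctor ρ),
      ∀ (X Y : EquivariantObject ρ) (t : Y ⟶ (D.equivariantFunctor ρ).obj X),
        (E.φ X Y).symm t = D.psi ρ X Y t := by
  -- The last component is definitional, since `equivariant` takes the inverse of $\psi$ as its
  -- duality isomorphism.
  exact ⟨D.psi_natural_left, D.psi_natural_right, D.psi_bijective hG, EquivariantObject.finite_hom,
    D.equivariant ρ hG, fun _ _ _ => rfl⟩
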